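/- Setting. Let $V=\coprod_{a\in\mathbb Z}V_{(a)}$ be a grading-restricted vertex algebra over $\mathbb C$ (no conformal vector is required) and let $W$ be a lower-bounded generalized $V$-module: $W=\coprod_{h\in\mathbb C}W_{[h]}$, where $W_{[h]}$ is the generalized eigenspace of $L_W(0)$ with eigenvalue $h$ and $W_{[h]}=0$ when $\operatorname{Re}h$ is sufficiently negative. Write $Y_W(v,x)=\sum_{m\in\mathbb Z}(Y_W)_m(v)x^{-m-1}$. Let $U^\infty(V)$ and $U^\infty(W)$ be the spaces of column-finite matrices, with rows and columns indexed by $\mathbb N=\{0,1,2,\dots\}$, with entries in $V$ and in $W$ respectively, and let $[w]_{kl}$ be the matrix whose $(k,l)$ entry is $w$ and whose other entries are $0$. The left and right actions $\diamond$ of $U^\infty(V)$ on $U^\infty(W)$ are given, for $v\in V$, $w\in W$, by $[v]_{km}\diamond[w]_{nl}=0=[w]_{km}\diamond[v]_{nl}$ if $m\neq n$, and $$[v]_{kn}\diamond[w]_{nl}=\sum_{m=0}^{n}\binom{-k+n-l-1}{m}\operatorname{Res}_x x^{-k+n-l-m-1}(1+x)^l\left[Y_W((1+x)^{L_V(0)}v,x)w\right]_{kl},$$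 $$[w]_{kn}\diamond[v]_{nl}=\sum_{m=0}^{n}\binom{-k+n-l-1}{m}\operatorname{Res}_x x^{-k+n-l-m-1}(1+x)^k\left[Y_W((1+x)^{-L_V(0)}v,-x(1+x)^{-1})w\right]_{kl}.$$ For a lower-bounded generalized $V$-module $W_i$ and a class $\mu\in\mathbb C/\mathbb Z$ containing a weight of $W_i$, let $h_i^\mu\in\mu$ be the lowest weight of $W_i$ in the class $\mu$, and let $\Gamma(W_i)$ be the set of these classes. Let $W_2,W_3$ be lower-bounded generalized $V$-modules and let $\mathcal Y$ be a logarithmic intertwining operator of type $\binom{W_3}{W\,W_2}$, that is, a linear map $W\otimes W_2\to W_3[\log x]\{x\}$, $w\otimes w_2\mapsto\mathcal Y(w,x)w_2=\sum_{m\in\mathbb C}\sum_{k\in\mathbb N}\mathcal Y_{m,k}(w)w_2\,x^{-m-1}(\log x)^k$, that satisfies lower truncation, the Jacobi identity, the $L(-1)$-derivative property and the $L(-1)$- and $L(0)$-commutator formulas, and such that, for all $w\in W$ and $w_2\in W_2$, the powers of $x$ in $\mathcal Y(w,x)w_2$ lie in finitely many classes of $\mathbb C/\mathbb Z$. Let $\vartheta_{\mathcal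 Y}:U^\infty(W)\to\operatorname{Hom}(W_2,W_3)$ be the linear map such that, for $w_2\in (W_2)_{[h_2^\mu+r]}$ with $\mu\in\Gamma(W_2)$ and $r\in\mathbb N$, $\vartheta_{\mathcal Y}([w]_{kl})w_2=0$ if $r\ne l$, and if $r=l$ then $$\vartheta_{\mathcal Y}([w]_{kl})w_2=\sum_{\nu\in\Gamma(W_3)}\operatorname{Coeff}^0_{\log x}\operatorname{Res}_x x^{h_2^\mu-h_3^\nu+l-k-1}\,\mathcal Y(x^{L_W(0)}w,x)w_2,$$ and such that $\vartheta_{\mathcal Y}([w_{kl}])w_2=\sum_{k,l\in\mathbb N}\vartheta_{\mathcal Y}([w_{kl}]_{kl})w_2$ for every matrix in $U^\infty(W)$ with entries $w_{kl}$. Let $Q^\infty(W)$ be the intersection of $\ker\vartheta_{\mathcal Y}$ over all such $W_2$, $W_3$ and $\mathcal Y$. Proposition. For $k,l,n\in\mathbb N$, $p\in\mathbb Z$ with $l+p\ge 0$, homogeneous $v\in V$ of weight $\operatorname{wt}v$, and $w\in W$, the element $$\sum_{\substack{j\in\mathbb N\\ n+p-j\ge0}}(-1)^j\binom pj[v]_{k,n+p-j}\diamond[w]_{n+p-j,l+p}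 -\sum_{\substack{j\in\mathbb N\\ l-n+k+p-j\ge0}}(-1)^{p-j}\binom pj[w]_{k,l-n+k+p-j}\diamond[v]_{l-n+k+p-j,l+p} -\sum_{j\in\mathbb N}\binom{\operatorname{wt}v+n-k-1}{j}\left[(Y_W)_{p+j}(v)w\right]_{k,l+p}$$ of $U^\infty(W)$ lies in $Q^\infty(W)$. -/

import Mathlib

universe u v v₁ v₂ v₃

noncomputable section

/-- The projection of a vector space onto the `i`-th summand of an internal direct sum
decomposition, as an endomorphism. -/
def homComponent {ι : Type*} [DecidableEq ι] {M : Type*} [AddCommGroup M] [Module ℂ M]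
    (A : ι → Submodule ℂ M) (hA : DirectSum.IsInternal A) (i : ι) : M →ₗ[ℂ] M :=
  (A i).subtype ∘ₗ DirectSum.component ℂ ι (fun j => A j) i ∘ₗ
    (LinearEquiv.ofBijective (DirectSum.coeLinearMap A) hA).symm.toLinearMap

theorem homComponent_finite {ι : Type*} [DecidableEq ι] {M : Type*} [AddCommGroup M]
    [Module ℂ M] (A : ι → Submodule ℂ M) (hA : DirectSum.IsInternal A) (x : M) :
    {i | homComponent A hA i x ≠ 0}.Finite := by
  classical
  refine (((LinearEquiv.ofBijective (DirectSum.coeLinearMap A) hA).symm x).support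
    |>.finite_toSet).subset ?_
  intro i hi
  simp only [Finset.mem_coe, DFinsupp.mem_support_toFun]
  intro h0
  apply hi
  simp only [homComponent, LinearMap.comp_apply, LinearEquiv.coe_coe, Submodule.subtype_apply]
  exact (congrArg Subtype.val h0 : _)

/-- A grading-restricted vertex algebra structure on a complex vector space `V`.
`Y u` is the vertex operator `Y_V(u, x) = ∑ₙ uₙ x^(-n-1)` and `(Y u).ncoeff n` is the mode `uₙ`.
Mathlib's `VertexOperator` includes the lower truncation of `Y_V(u, x) v`. -/
structure GradingRestrictedVertexAlgebra (V : Type u) [AddCommGroup V] [Module ℂ V] where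
  /-- the homogeneous subspace `V_(n)` of weight `n` -/
  wt : ℤ → Submodule ℂ V
  isInternal : DirectSum.IsInternal wt
  finiteDimensional : ∀ n, FiniteDimensional ℂ (wt n)
  lowerBounded : ∃ N : ℤ, ∀ n < N, wt n = ⊥
  /-- the vertex operator map -/
  Y : V →ₗ[ℂ] VertexOperator ℂ V
  /-- the vacuum -/
  one : V
  one_mem : one ∈ wt 0
  /-- the operator `L_V(0)`, acting on `V_(n)` as multiplication by `n` -/
  L0 : Module.End ℂ V
  L0_apply : ∀ (n : ℤ), ∀ v ∈ wt n, L0 v = (n : ℂ) • v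
  /-- the operator `L_V(-1)`, given by `L_V(-1) v = v₋₂ 1` -/
  Lm1 : Module.End ℂ V
  Lm1_apply : ∀ v, Lm1 v = (Y v).ncoeff (-2) one
  /-- `Y_V(1, x) = 1_V` -/
  identity : ∀ (n : ℤ) (v : V), (Y one).ncoeff n v = if n = -1 then v else 0
  /-- `Y_V(v, x) 1` is a power series in `x` with constant term `v` -/
  creation : ∀ v : V, (∀ n : ℤ, 0 ≤ n → (Y v).ncoeff n one = 0) ∧ (Y v).ncoeff (-1) one = v
  /-- `[L_V(0), Y_V(u, x)] = Y_V(L_V(0) u, x) + x (d/dx) Y_V(u, x)` -/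
  L0_bracket : ∀ (u v : V) (n : ℤ),
    L0 ((Y u).ncoeff n v) - (Y u).ncoeff n (L0 v)
      = (Y (L0 u)).ncoeff n v + (-n - 1) • (Y u).ncoeff n v
  /-- `(d/dx) Y_V(u, x) = Y_V(L_V(-1) u, x)` -/
  Lm1_derivative : ∀ (u v : V) (n : ℤ),
    (Y (Lm1 u)).ncoeff n v = (-n) • (Y u).ncoeff (n - 1) v
  /-- `[L_V(-1), Y_V(u, x)] = Y_V(L_V(-1) u, x)` -/
  Lm1_bracket : ∀ (u v : V) (n : ℤ),
    Lm1 ((Y u).ncoeff n v) - (Y u).ncoeff n (Lm1 v) = (Y (Lm1 u)).ncoeff n v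
  /-- The Jacobi identity
  `x₀⁻¹δ((x₁-x₂)/x₀)Y(u,x₁)Y(v,x₂) - x₀⁻¹δ((x₂-x₁)/(-x₀))Y(v,x₂)Y(u,x₁)
    = x₂⁻¹δ((x₁-x₀)/x₂)Y(Y(u,x₀)v,x₂)`,
  read off as the coefficient of `x₀^(-q-1) x₁^(-m-1) x₂^(-n-1)`; all sums are finite. -/
  jacobi : ∀ (u v w : V) (q m n : ℤ),
    (∑ᶠ i : ℕ, ((-1 : ℤ) ^ i * Ring.choose q i) •
        (Y u).ncoeff (m + q - i) ((Y v).ncoeff (n + i) w))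
      - (∑ᶠ i : ℕ, ((((-1 : ℤˣ) ^ (q - i) : ℤˣ) : ℤ) * Ring.choose q i) •
        (Y v).ncoeff (n + q - i) ((Y u).ncoeff (m + i) w))
      = ∑ᶠ i : ℕ, Ring.choose m i •
        (Y ((Y u).ncoeff (q + i) v)).ncoeff (m + n - i) w

/-- A lower-bounded generalized module for a grading-restricted vertex algebra, on a complex
vector space `W`. The homogeneous subspace `W_[h]` of (complex) weight `h` is the generalized
eigenspace of `L_W(0)` with eigenvalue `h`, and `(Y v).ncoeff n` is the mode `(Y_W)_n(v)`. -/
structure LowerBoundedGeneralizedModule {V : Type u} [AddCommGroup V] [Module ℂ V]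
    (𝒱 : GradingRestrictedVertexAlgebra V) (W : Type v) [AddCommGroup W] [Module ℂ W] where
  /-- the vertex operator map `Y_W` -/
  Y : V →ₗ[ℂ] VertexOperator ℂ W
  /-- the operator `L_W(0)` -/
  L0 : Module.End ℂ W
  /-- the operator `L_W(-1)` -/
  Lm1 : Module.End ℂ W
  isInternal : DirectSum.IsInternal (fun h : ℂ => L0.maxGenEigenspace h)
  lowerBounded : ∃ B : ℝ, ∀ h : ℂ, h.re < B → L0.maxGenEigenspace h = ⊥
  /-- `Y_W(1, x) = 1_W` -/
  identity : ∀ (n : ℤ) (w : W), (Y 𝒱.one).ncoeff n w = if n = -1 then w else 0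
  /-- `[L_W(0), Y_W(v, x)] = Y_W(L_V(0) v, x) + x (d/dx) Y_W(v, x)` -/
  L0_bracket : ∀ (v : V) (w : W) (n : ℤ),
    L0 ((Y v).ncoeff n w) - (Y v).ncoeff n (L0 w)
      = (Y (𝒱.L0 v)).ncoeff n w + (-n - 1) • (Y v).ncoeff n w
  /-- `(d/dx) Y_W(v, x) = Y_W(L_V(-1) v, x)` -/
  Lm1_derivative : ∀ (v : V) (w : W) (n : ℤ),
    (Y (𝒱.Lm1 v)).ncoeff n w = (-n) • (Y v).ncoeff (n - 1) w
  /-- `[L_W(-1), Y_W(v, x)] = Y_W(L_V(-1) v, x)` -/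
  Lm1_bracket : ∀ (v : V) (w : W) (n : ℤ),
    Lm1 ((Y v).ncoeff n w) - (Y v).ncoeff n (Lm1 w) = (Y (𝒱.Lm1 v)).ncoeff n w
  /-- `[L_W(0), L_W(-1)] = L_W(-1)` -/
  L0_Lm1 : ∀ w : W, L0 (Lm1 w) - Lm1 (L0 w) = Lm1 w
  /-- The Jacobi identity, coefficientwise. -/
  jacobi : ∀ (u v : V) (w : W) (q m n : ℤ),
    (∑ᶠ i : ℕ, ((-1 : ℤ) ^ i * Ring.choose q i) •
        (Y u).ncoeff (m + q - i) ((Y v).ncoeff (n + i) w))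
      - (∑ᶠ i : ℕ, ((((-1 : ℤˣ) ^ (q - i) : ℤˣ) : ℤ) * Ring.choose q i) •
        (Y v).ncoeff (n + q - i) ((Y u).ncoeff (m + i) w))
      = ∑ᶠ i : ℕ, Ring.choose m i •
        (Y ((𝒱.Y u).ncoeff (q + i) v)).ncoeff (m + n - i) w

section

variable {V : Type u} [AddCommGroup V] [Module ℂ V] {𝒱 : GradingRestrictedVertexAlgebra V}
  {W : Type v} [AddCommGroup W] [Module ℂ W]

/-- The component of `v` in `V_(a)`. -/
def GradingRestrictedVertexAlgebra.comp (𝒱 : GradingRestrictedVertexAlgebra V) (a : ℤ) :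
    V →ₗ[ℂ] V :=
  homComponent 𝒱.wt 𝒱.isInternal a

namespace LowerBoundedGeneralizedModule

/-- The homogeneous subspace `W_[h]`. -/
def wt (M : LowerBoundedGeneralizedModule 𝒱 W) (h : ℂ) : Submodule ℂ W :=
  M.L0.maxGenEigenspace h

/-- The component of `w` in `W_[h]`. -/
def comp (M : LowerBoundedGeneralizedModule 𝒱 W) (h : ℂ) : W →ₗ[ℂ] W :=
  homComponent M.wt M.isInternal h

/-- `f = h^μ + n`, where `h^μ` is the lowest weight of `W` in the congruence class `μ` of `f`
modulo `ℤ`. The level `W_⟨n⟩` is the direct sum of the `W_[f]` over these `f`. -/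
def IsLevel (M : LowerBoundedGeneralizedModule 𝒱 W) (n : ℕ) (f : ℂ) : Prop :=
  ∃ h : ℂ, M.wt h ≠ ⊥ ∧ (∀ j : ℕ, M.wt (h - (j + 1)) = ⊥) ∧ f = h + n

theorem IsLevel.unique {M : LowerBoundedGeneralizedModule 𝒱 W} {n n' : ℕ} {f f' : ℂ}
    (hf : M.IsLevel n f) (hf' : M.IsLevel n' f') (z : ℤ) (hz : f' = f + z) : n' = n + z := by
  obtain ⟨h, h1, h2, rfl⟩ := hf
  obtain ⟨h', h1', h2', rfl⟩ := hf'
  have key : h' = h + ((n + z - n' : ℤ) : ℂ) := by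
    push_cast
    linear_combination hz
  rcases lt_trichotomy ((n : ℤ) + z - n') 0 with hlt | heq | hgt
  · exfalso
    apply h1'
    have := h2 ((-((n : ℤ) + z - n') - 1).toNat)
    have hc : (((-((n : ℤ) + z - n') - 1).toNat : ℕ) : ℂ) = ((-((n : ℤ) + z - n') - 1 : ℤ) : ℂ) := by
      rw [← Int.cast_natCast, Int.toNat_of_nonneg (by omega)]
    rw [hc] at this
    rw [key]
    convert this using 2
    push_cast
    ring
  · omega
  · exfalso
    apply h1
    have := h2' ((((n : ℤ) + z - n') - 1).toNat)
    have hc : (((((n : ℤ) + z - n') - 1).toNat : ℕ) : ℂ) = ((((n : ℤ) + z - n') - 1 : ℤ) : ℂ) := by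
      rw [← Int.cast_natCast, Int.toNat_of_nonneg (by omega)]
    rw [hc, key] at this
    convert this using 2
    push_cast
    ring

end LowerBoundedGeneralizedModule

variable (W) in
/-- The space `U^∞(W)` of column-finite matrices with entries in `W`, indexed by `ℕ × ℕ`. -/
def UInf : Submodule ℂ (Matrix ℕ ℕ W) where
  carrier := {A | ∀ l, {k | A k l ≠ 0}.Finite}
  zero_mem' := fun l => by simp
  add_mem' := fun {A B} hA hB l => ((hA l).union (hB l)).subset fun k hk => by
    by_contra hcon
    simp only [Set.mem_union, Set.mem_ofPred_eq, not_or, not_not] at hcon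
    exact hk (by simp [hcon.1, hcon.2])
  smul_mem' := fun c A hA l => (hA l).subset fun k hk hcon => hk (by
    simp [hcon])

/-- The matrix `[w]_{kl}` whose `(k, l)` entry is `w` and whose other entries are `0`. -/
def UInf.single (k l : ℕ) (w : W) : UInf W :=
  ⟨Matrix.single k l w, fun l' => (Set.finite_singleton k).subset fun k' hk' => by
    by_contra hcon
    exact hk' (Matrix.single_apply_of_ne _ _ _ _ _ (fun h => hcon h.1.symm))⟩

/-- The entry of `[v]_{kn} ⋄ [w]_{nl}`, that is,
`∑_{m=0}^n binom(-k+n-l-1, m) Res_x x^(-k+n-l-m-1) (1+x)^l Y_W((1+x)^{L_V(0)} v, x) w`.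
On the component of `v` of weight `a`, the factor `(1+x)^(l+a)` is expanded in nonnegative powers
of `x`. -/
def leftEntry (M : LowerBoundedGeneralizedModule 𝒱 W) (k n l : ℕ) (v : V) (w : W) : W :=
  ∑ᶠ a : ℤ, ∑ m ∈ Finset.range (n + 1), Ring.choose (-k + n - l - 1 : ℤ) m •
    ∑ᶠ i : ℕ, Ring.choose (l + a : ℤ) i •
      (M.Y (𝒱.comp a v)).ncoeff (-k + n - l - m - 1 + i) w

/-- The entry of `[w]_{kn} ⋄ [v]_{nl}`, that is,
`∑_{m=0}^n binom(-k+n-l-1, m)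
  Res_x x^(-k+n-l-m-1) (1+x)^k Y_W((1+x)^{-L_V(0)} v, -x(1+x)⁻¹) w`.
On the component of `v` of weight `a`, the integrand is the sum over `r ∈ ℤ` of
`(-1)^(r+1) x^(-k+n-l-m-1-r-1) (1+x)^(k-a+r+1) v_r w`, and its residue is found by expanding the
power of `1+x` in nonnegative powers `x^i`, where `r = -k+n-l-m-1+i`. -/
def rightEntry (M : LowerBoundedGeneralizedModule 𝒱 W) (k n l : ℕ) (w : W) (v : V) : W :=
  ∑ᶠ a : ℤ, ∑ m ∈ Finset.range (n + 1), Ring.choose (-k + n - l - 1 : ℤ) m •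
    ∑ᶠ i : ℕ, (fun r : ℤ =>
        ((((-1 : ℤˣ) ^ (r + 1) : ℤˣ) : ℤ) * Ring.choose (k - a + r + 1) i) •
          (M.Y (𝒱.comp a v)).ncoeff r w)
      (-k + n - l - m - 1 + i)

theorem leftEntry_zero_left (M : LowerBoundedGeneralizedModule 𝒱 W) (k n l : ℕ) (w : W) :
    leftEntry M k n l 0 w = 0 := by
  simp [leftEntry]

theorem leftEntry_zero_right (M : LowerBoundedGeneralizedModule 𝒱 W) (k n l : ℕ) (v : V) :
    leftEntry M k n l v 0 = 0 := by
  simp [leftEntry]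

theorem rightEntry_zero_left (M : LowerBoundedGeneralizedModule 𝒱 W) (k n l : ℕ) (v : V) :
    rightEntry M k n l 0 v = 0 := by
  simp [rightEntry]

theorem rightEntry_zero_right (M : LowerBoundedGeneralizedModule 𝒱 W) (k n l : ℕ) (w : W) :
    rightEntry M k n l w 0 = 0 := by
  simp [rightEntry]

/-- A "matrix product" of column-finite matrices, for a family of products `f k n l` of entries,
is column-finite. -/
theorem columnFinite_mul {X Y Z : Type*} [AddCommGroup X] [Module ℂ X] [AddCommGroup Y]
    [Module ℂ Y] [AddCommGroup Z] [Module ℂ Z] (f : ℕ → ℕ → ℕ → X → Y → Z)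
    (h0 : ∀ k n l y, f k n l 0 y = 0) (h0' : ∀ k n l x, f k n l x 0 = 0)
    (A : UInf X) (B : UInf Y) (l : ℕ) :
    {k | (∑ᶠ n, f k n l (A.1 k n) (B.1 n l)) ≠ 0}.Finite := by
  refine ((B.2 l).biUnion fun n _ => A.2 n).subset fun k hk => ?_
  by_contra hcon
  apply hk
  rw [← finsum_zero (α := ℕ)]
  refine finsum_congr fun n => ?_
  by_cases hB : B.1 n l = 0
  · rw [hB, h0']
  · have hA : A.1 k n = 0 := by
      by_contra hA
      exact hcon (Set.mem_biUnion (show n ∈ {n | B.1 n l ≠ 0} from hB) hA)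
    rw [hA, h0]

/-- The left action `𝔳 ⋄ 𝔴` of `U^∞(V)` on `U^∞(W)`. -/
def leftDiamond (M : LowerBoundedGeneralizedModule 𝒱 W) (A : UInf V) (B : UInf W) : UInf W :=
  ⟨Matrix.of fun k l => ∑ᶠ n : ℕ, leftEntry M k n l (A.1 k n) (B.1 n l),
    fun l => columnFinite_mul (leftEntry M) (leftEntry_zero_left M) (leftEntry_zero_right M) A B l⟩

/-- The right action `𝔴 ⋄ 𝔳` of `U^∞(V)` on `U^∞(W)`. -/
def rightDiamond (M : LowerBoundedGeneralizedModule 𝒱 W) (B : UInf W) (A : UInf V) : UInf W :=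
  ⟨Matrix.of fun k l => ∑ᶠ n : ℕ, rightEntry M k n l (B.1 k n) (A.1 n l),
    fun l => columnFinite_mul (rightEntry M) (rightEntry_zero_left M)
      (rightEntry_zero_right M) B A l⟩

end

/-- A (logarithmic) intertwining operator of type `(W₃; W₁ W₂)` with locally-finite sets of
congruence classes of powers:
`𝒴(w, x) w₂ = ∑_{m ∈ ℂ} ∑_{k ∈ ℕ} 𝒴_{m,k}(w) w₂ x^(-m-1) (log x)^k ∈ W₃[log x]{x}`,
where `mode m k w w₂` is `𝒴_{m,k}(w) w₂`. -/
structure IntertwiningOperator {V : Type u} [AddCommGroup V] [Module ℂ V]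
    {𝒱 : GradingRestrictedVertexAlgebra V}
    {W₁ : Type v₁} [AddCommGroup W₁] [Module ℂ W₁] {W₂ : Type v₂} [AddCommGroup W₂] [Module ℂ W₂]
    {W₃ : Type v₃} [AddCommGroup W₃] [Module ℂ W₃]
    (M₁ : LowerBoundedGeneralizedModule 𝒱 W₁) (M₂ : LowerBoundedGeneralizedModule 𝒱 W₂)
    (M₃ : LowerBoundedGeneralizedModule 𝒱 W₃) where
  mode : ℂ → ℕ → W₁ →ₗ[ℂ] W₂ →ₗ[ℂ] W₃
  /-- the coefficient of each power of `x` is a polynomial in `log x` -/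
  polynomial_log : ∀ (w : W₁) (w₂ : W₂) (m : ℂ), {k | mode m k w w₂ ≠ 0}.Finite
  /-- lower truncation, uniform in the power of `log x` -/
  truncation : ∀ (w : W₁) (w₂ : W₂) (m : ℂ), ∃ N : ℕ, ∀ j : ℕ, N ≤ j → ∀ k,
    mode (m + j) k w w₂ = 0
  /-- the powers of `x` in `𝒴(w, x) w₂` lie in finitely many congruence classes modulo `ℤ` -/
  finite_classes : ∀ (w : W₁) (w₂ : W₂),
    ((fun m : ℂ => (m : ℂ ⧸ AddSubgroup.zmultiples (1 : ℂ))) ''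
      {m | ∃ k, mode m k w w₂ ≠ 0}).Finite
  /-- `(d/dx) 𝒴(w, x) = 𝒴(L_{W₁}(-1) w, x)` -/
  Lm1_derivative : ∀ (w : W₁) (w₂ : W₂) (m : ℂ) (k : ℕ),
    mode m k (M₁.Lm1 w) w₂
      = (-m) • mode (m - 1) k w w₂ + ((k : ℂ) + 1) • mode (m - 1) (k + 1) w w₂
  /-- `[L(-1), 𝒴(w, x)] = 𝒴(L(-1) w, x)` -/
  Lm1_bracket : ∀ (w : W₁) (w₂ : W₂) (m : ℂ) (k : ℕ),
    M₃.Lm1 (mode m k w w₂) - mode m k w (M₂.Lm1 w₂) = mode m k (M₁.Lm1 w) w₂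
  /-- `[L(0), 𝒴(w, x)] = 𝒴(L(0) w, x) + x 𝒴(L(-1) w, x)` -/
  L0_bracket : ∀ (w : W₁) (w₂ : W₂) (m : ℂ) (k : ℕ),
    M₃.L0 (mode m k w w₂) - mode m k w (M₂.L0 w₂)
      = mode m k (M₁.L0 w) w₂ + mode (m + 1) k (M₁.Lm1 w) w₂
  /-- The Jacobi identity
  `x₀⁻¹δ((x₁-x₂)/x₀)Y(v,x₁)𝒴(w,x₂)w₂ - x₀⁻¹δ((x₂-x₁)/(-x₀))𝒴(w,x₂)Y(v,x₁)w₂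
    = x₂⁻¹δ((x₁-x₀)/x₂)𝒴(Y(v,x₀)w,x₂)w₂`,
  read off as the coefficient of `x₀^(-q-1) x₁^(-m-1) x₂^(-n-1) (log x₂)^k`. -/
  jacobi : ∀ (v : V) (w : W₁) (w₂ : W₂) (q m : ℤ) (n : ℂ) (k : ℕ),
    (∑ᶠ i : ℕ, ((-1 : ℤ) ^ i * Ring.choose q i) •
        (M₃.Y v).ncoeff (m + q - i) (mode (n + i) k w w₂))
      - (∑ᶠ i : ℕ, ((((-1 : ℤˣ) ^ (q - i) : ℤˣ) : ℤ) * Ring.choose q i) •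
        mode (n + q - i) k w ((M₂.Y v).ncoeff (m + i) w₂))
      = ∑ᶠ i : ℕ, Ring.choose m i •
        mode (m + n - i) k ((M₁.Y v).ncoeff (q + i) w) w₂

namespace IntertwiningOperator

variable {V : Type u} [AddCommGroup V] [Module ℂ V] {𝒱 : GradingRestrictedVertexAlgebra V}
  {W₁ : Type v₁} [AddCommGroup W₁] [Module ℂ W₁] {W₂ : Type v₂} [AddCommGroup W₂] [Module ℂ W₂]
  {W₃ : Type v₃} [AddCommGroup W₃] [Module ℂ W₃]
  {M₁ : LowerBoundedGeneralizedModule 𝒱 W₁} {M₂ : LowerBoundedGeneralizedModule 𝒱 W₂}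
  {M₃ : LowerBoundedGeneralizedModule 𝒱 W₃}

open Classical in
/-- One term of `ϑ_𝒴([w]_{kl}) w₂`. For `w` of weight `h`, `w₂` of weight `g = h₂^μ + l` and
`f = h₃^ν + k`, the coefficient of `(log x)^0` in
`Res_x x^(h₂^μ - h₃^ν + l - k - 1) 𝒴(x^{L_W(0)} w, x) w₂` is `𝒴_{m,0}(w) w₂` where
`m = h + h₂^μ - h₃^ν + l - k - 1 = h + g - f - 1`. -/
def thetaTerm (I : IntertwiningOperator M₁ M₂ M₃) (k l : ℕ) (t : ℂ × ℂ × ℂ) :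
    W₁ →ₗ[ℂ] W₂ →ₗ[ℂ] W₃ :=
  if M₂.IsLevel l t.2.1 ∧ M₃.IsLevel k t.2.2 then
    (I.mode (t.1 + t.2.1 - t.2.2 - 1) 0).compl₁₂ (M₁.comp t.1) (M₂.comp t.2.1)
  else 0

theorem thetaTerm_eq_zero (I : IntertwiningOperator M₁ M₂ M₃) {k l : ℕ} {t : ℂ × ℂ × ℂ}
    (h : ¬ (M₂.IsLevel l t.2.1 ∧ M₃.IsLevel k t.2.2)) : I.thetaTerm k l t = 0 := if_neg h

theorem thetaTerm_apply (I : IntertwiningOperator M₁ M₂ M₃) {k l : ℕ} {t : ℂ × ℂ × ℂ}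
    (h : M₂.IsLevel l t.2.1 ∧ M₃.IsLevel k t.2.2) (w : W₁) (w₂ : W₂) :
    I.thetaTerm k l t w w₂ =
      I.mode (t.1 + t.2.1 - t.2.2 - 1) 0 (M₁.comp t.1 w) (M₂.comp t.2.1 w₂) := by
  rw [thetaTerm, if_pos h, LinearMap.compl₁₂_apply]

theorem thetaTerm_finite (I : IntertwiningOperator M₁ M₂ M₃) (k l : ℕ) (w : W₁) (w₂ : W₂) :
    {t | I.thetaTerm k l t w w₂ ≠ 0}.Finite := by
  have h1 : {h | M₁.comp h w ≠ 0}.Finite := homComponent_finite _ M₁.isInternal w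
  have h2 : {g | M₂.comp g w₂ ≠ 0}.Finite := homComponent_finite _ M₂.isInternal w₂
  have h3 : ∀ h g : ℂ, {f | M₃.IsLevel k f ∧
      I.mode (h + g - f - 1) 0 (M₁.comp h w) (M₂.comp g w₂) ≠ 0}.Finite := by
    intro h g
    refine Set.Finite.of_finite_image
      (f := fun f : ℂ => ((h + g - f - 1 : ℂ) : ℂ ⧸ AddSubgroup.zmultiples (1 : ℂ)))
      ((I.finite_classes (M₁.comp h w) (M₂.comp g w₂)).subset ?_) ?_
    · rintro _ ⟨f, ⟨-, hf⟩, rfl⟩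
      exact ⟨h + g - f - 1, ⟨0, hf⟩, rfl⟩
    · rintro f ⟨hf, -⟩ f' ⟨hf', -⟩ heq
      obtain ⟨z, hz⟩ := AddSubgroup.mem_zmultiples_iff.1 (QuotientAddGroup.eq.1 heq)
      have hz' : f = f' + z := by
        have : (z : ℂ) = f - f' := by
          have hz1 : (z : ℂ) = -(h + g - f - 1) + (h + g - f' - 1) := by
            rw [← hz]; simp
          rw [hz1]; ring
        rw [this]; ring
      have := hf'.unique hf z hz'
      have z0 : z = 0 := by omega
      rw [hz', z0]; simp
  refine ((h1.prod (h2.biUnion fun g _ => h1.biUnion fun h _ =>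
    (Set.finite_singleton g).prod (h3 h g))).subset ?_)
  rintro ⟨h, g, f⟩ ht
  simp only [Set.mem_ofPred_eq] at ht
  by_cases hl : M₂.IsLevel l g ∧ M₃.IsLevel k f
  · rw [thetaTerm_apply I hl] at ht
    have hw : M₁.comp h w ≠ 0 := fun h0 => ht (by simp [h0])
    have hw₂ : M₂.comp g w₂ ≠ 0 := fun h0 => ht (by simp [h0])
    refine ⟨hw, Set.mem_biUnion (show g ∈ {g | M₂.comp g w₂ ≠ 0} from hw₂)
      (Set.mem_biUnion (show h ∈ {h | M₁.comp h w ≠ 0} from hw) ⟨rfl, hl.2, ht⟩)⟩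
  · exact absurd (by rw [thetaTerm_eq_zero I hl]; rfl) ht

/-- `ϑ_𝒴([w]_{kl}) w₂`, bilinear in `w` and `w₂`; it vanishes on all levels of `W₂` but the
`l`-th. The sum is finite. -/
def thetaEntry (I : IntertwiningOperator M₁ M₂ M₃) (k l : ℕ) : W₁ →ₗ[ℂ] W₂ →ₗ[ℂ] W₃ :=
  LinearMap.mk₂ ℂ (fun w w₂ => ∑ᶠ t : ℂ × ℂ × ℂ, I.thetaTerm k l t w w₂)
    (fun w w' w₂ => by
      simp only [map_add, LinearMap.add_apply]
      exact finsum_add_distrib (I.thetaTerm_finite k l w w₂) (I.thetaTerm_finite k l w' w₂))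
    (fun c w w₂ => by
      simp only [map_smul, LinearMap.smul_apply]
      exact (smul_finsum' c (I.thetaTerm_finite k l w w₂)).symm)
    (fun w w₂ w₂' => by
      simp only [map_add]
      exact finsum_add_distrib (I.thetaTerm_finite k l w w₂) (I.thetaTerm_finite k l w w₂'))
    (fun c w w₂ => by
      simp only [map_smul]
      exact (smul_finsum' c (I.thetaTerm_finite k l w w₂)).symm)

theorem thetaEntry_finite (I : IntertwiningOperator M₁ M₂ M₃) (A : UInf W₁) (w₂ : W₂) :
    {s : ℕ × ℕ | I.thetaEntry s.1 s.2 (A.1 s.1 s.2) w₂ ≠ 0}.Finite := by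
  have h2 : {g | M₂.comp g w₂ ≠ 0}.Finite := homComponent_finite _ M₂.isInternal w₂
  have hl : {l | ∃ g, M₂.comp g w₂ ≠ 0 ∧ M₂.IsLevel l g}.Finite := by
    have : {l | ∃ g, M₂.comp g w₂ ≠ 0 ∧ M₂.IsLevel l g} =
        ⋃ g ∈ {g | M₂.comp g w₂ ≠ 0}, {l | M₂.IsLevel l g} := by
      ext l; simp
    rw [this]
    refine h2.biUnion fun g _ => Set.Subsingleton.finite fun l hl l' hl' => ?_
    have := hl.unique hl' 0 (by simp)
    omega
  refine (hl.biUnion fun l _ => (A.2 l).prod (Set.finite_singleton l)).subset ?_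
  rintro ⟨k, l⟩ hs
  simp only [Set.mem_ofPred_eq] at hs
  have hA : A.1 k l ≠ 0 := fun h0 => hs (by simp [h0])
  have hex : ∃ g, M₂.comp g w₂ ≠ 0 ∧ M₂.IsLevel l g := by
    by_contra hcon
    push Not at hcon
    apply hs
    simp only [thetaEntry, LinearMap.mk₂_apply]
    rw [← finsum_zero (α := ℂ × ℂ × ℂ)]
    refine finsum_congr fun t => ?_
    by_cases ht : M₂.IsLevel l t.2.1 ∧ M₃.IsLevel k t.2.2
    · rw [thetaTerm_apply I ht]
      have : M₂.comp t.2.1 w₂ = 0 := by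
        by_contra h0
        exact hcon _ h0 ht.1
      simp [this]
    · rw [thetaTerm_eq_zero I ht]; rfl
  exact Set.mem_biUnion (show l ∈ {l | ∃ g, M₂.comp g w₂ ≠ 0 ∧ M₂.IsLevel l g} from hex) ⟨hA, rfl⟩

/-- The linear map `ϑ_𝒴 : U^∞(W) → Hom(W₂, W₃)`. -/
def theta (I : IntertwiningOperator M₁ M₂ M₃) : UInf W₁ →ₗ[ℂ] W₂ →ₗ[ℂ] W₃ :=
  LinearMap.mk₂ ℂ (fun A w₂ => ∑ᶠ s : ℕ × ℕ, I.thetaEntry s.1 s.2 (A.1 s.1 s.2) w₂)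
    (fun A B w₂ => by
      rw [← finsum_add_distrib (I.thetaEntry_finite A w₂) (I.thetaEntry_finite B w₂)]
      exact finsum_congr fun s => by simp)
    (fun c A w₂ => by
      rw [smul_finsum' c (I.thetaEntry_finite A w₂)]
      exact finsum_congr fun s => by simp)
    (fun A w₂ w₂' => by
      rw [← finsum_add_distrib (I.thetaEntry_finite A w₂) (I.thetaEntry_finite A w₂')]
      exact finsum_congr fun s => by simp)
    (fun c A w₂ => by
      rw [smul_finsum' c (I.thetaEntry_finite A w₂)]
      exact finsum_congr fun s => by simp)

end IntertwiningOperator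

/-- `Q^∞(W)`: the intersection of the kernels of `ϑ_𝒴`, over all lower-bounded generalized modules
`W₂`, `W₃` and all intertwining operators `𝒴` of type `(W₃; W W₂)`. -/
def QInf {V : Type u} [AddCommGroup V] [Module ℂ V] {𝒱 : GradingRestrictedVertexAlgebra V}
    {W : Type v} [AddCommGroup W] [Module ℂ W] (M : LowerBoundedGeneralizedModule 𝒱 W) :
    Submodule ℂ (UInf W) where
  carrier := {A | ∀ (W₂ : Type v₂) [AddCommGroup W₂] [Module ℂ W₂]
    (W₃ : Type v₃) [AddCommGroup W₃] [Module ℂ W₃]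
    (M₂ : LowerBoundedGeneralizedModule 𝒱 W₂) (M₃ : LowerBoundedGeneralizedModule 𝒱 W₃)
    (I : IntertwiningOperator M M₂ M₃), A ∈ LinearMap.ker I.theta}
  zero_mem' := fun _ _ _ _ _ _ _ _ _ => zero_mem _
  add_mem' := fun hA hB W₂ _ _ W₃ _ _ M₂ M₃ I => add_mem (hA W₂ W₃ M₂ M₃ I) (hB W₂ W₃ M₂ M₃ I)
  smul_mem' := fun c _ hA W₂ _ _ W₃ _ _ M₂ M₃ I =>
    Submodule.smul_mem _ c (hA W₂ W₃ M₂ M₃ I)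

end

/-!
Fix an intertwining operator `𝒴` of type `(W₃; W W₂)`. The maps `ϑ` turn both actions `⋄` into
composition of modes: on a homogeneous `w₂` of level `l`, `ϑ_𝒴([v]_{kn} ⋄ [w]_{nl})` is the mode of
`w` that takes `w₂` to level `n`, followed by the mode of `v` that takes level `n` to level `k`
(`thetaComponent_leftEntryEnd`), and `ϑ_𝒴([w]_{kn} ⋄ [v]_{nl})` is the same with `v` acting first
(`thetaComponent_rightEntryEnd`). With these formulas, the image of the element of the proposition
under `ϑ_𝒴` is the difference of the two sides of the Jacobi identity for `v`, `w`, `w₂`, taken at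
the exponents `p` of `x₀` and `a + n - k - 1` of `x₁` (`thetaComponent_jacobi`). The restrictions
`n + p - j ≥ 0` and `l - n + k + p - j ≥ 0` lose nothing, as the other intermediate vectors would
lie below the lowest weight of their class.

For the composition formulas, the residues in the definition of `⋄` are iterates to which the Jacobi
identity applies. The exponents `l` and `k` of `1 + x` are such that one of the two terms of the
commutator side vanishes, again by the lower bound on weights, and the truncated sum over `m`
cancels all of the other term but its leading summand (`sum_range_choose_smul_finsum_alternating`).

Everything is tested on homogeneous `w` and `w₂` and on one weight `f` of `W₃` at a time
(`thetaComponent`). This uses that the modes of `𝒴` are homogeneous (`mode_mem_wt`), in spite of the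
powers of `log x` and of the nilpotent part of `L(0)`.
-/

/-! ### Components of internal direct sums -/

section HomComponent

variable {ι : Type*} [DecidableEq ι] {M : Type*} [AddCommGroup M] [Module ℂ M]
  {A : ι → Submodule ℂ M} (hA : DirectSum.IsInternal A)

theorem homComponent_of_mem {i : ι} {x : M} (hx : x ∈ A i) : homComponent A hA i x = x := by
  have h : (LinearEquiv.ofBijective (DirectSum.coeLinearMap A) hA).symm x
      = DirectSum.of (fun j => A j) i ⟨x, hx⟩ := by
    rw [LinearEquiv.symm_apply_eq]
    exact (DirectSum.coeLinearMap_of A i ⟨x, hx⟩).symm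
  change (((LinearEquiv.ofBijective (DirectSum.coeLinearMap A) hA).symm x) i : M) = x
  rw [h, DirectSum.of_eq_same]

theorem homComponent_of_mem_ne {i j : ι} (hij : j ≠ i) {x : M} (hx : x ∈ A j) :
    homComponent A hA i x = 0 := by
  have h : (LinearEquiv.ofBijective (DirectSum.coeLinearMap A) hA).symm x
      = DirectSum.of (fun j => A j) j ⟨x, hx⟩ := by
    rw [LinearEquiv.symm_apply_eq]
    exact (DirectSum.coeLinearMap_of A j ⟨x, hx⟩).symm
  change (((LinearEquiv.ofBijective (DirectSum.coeLinearMap A) hA).symm x) i : M) = 0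
  rw [h, DirectSum.of_eq_of_ne _ _ _ hij.symm, ZeroMemClass.coe_zero]

theorem eq_zero_of_homComponent_eq_zero {x : M} (h : ∀ i, homComponent A hA i x = 0) :
    x = 0 := by
  have h0 : (LinearEquiv.ofBijective (DirectSum.coeLinearMap A) hA).symm x = 0 := by
    ext i
    exact h i
  simpa using h0

/-- A linear map that vanishes on every summand of an internal direct sum is zero. -/
theorem apply_eq_zero_of_isInternal (hA : DirectSum.IsInternal A) {N : Type*} [AddCommGroup N]
    [Module ℂ N] (F : M →ₗ[ℂ] N) (h : ∀ i, ∀ x ∈ A i, F x = 0) (x : M) : F x = 0 := by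
  have hx : x ∈ ⨆ i, A i := by
    rw [hA.submodule_iSup_eq_top]
    exact Submodule.mem_top
  have hle : ⨆ i, A i ≤ LinearMap.ker F := iSup_le fun i y hy => h i y hy
  exact hle hx

end HomComponent

/-! ### An alternating binomial sum -/

theorem sum_range_choose_smul_alternating {X : Type*} [AddCommGroup X] (N : ℤ) (n : ℕ)
    (x : ℕ → X) :
    ∑ m ∈ Finset.range (n + 1), Ring.choose N m •
      ∑ i ∈ Finset.range (n + 1 - m), ((-1 : ℤ) ^ i * Ring.choose (N - m) i) • x (m + i)
      = x 0 := by
  have hcoef : ∀ s : ℕ, ∑ m ∈ Finset.range (s + 1),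
      Ring.choose N m * ((-1 : ℤ) ^ (s - m) * Ring.choose (N - m) (s - m))
        = if s = 0 then 1 else 0 := by
    intro s
    have h1 : ∀ m ∈ Finset.range (s + 1),
        Ring.choose N m * ((-1 : ℤ) ^ (s - m) * Ring.choose (N - m) (s - m))
          = Ring.choose N s * (-1) ^ s * ((-1) ^ m * s.choose m) := by
      intro m hm
      have hms : m ≤ s := Nat.lt_succ_iff.1 (Finset.mem_range.1 hm)
      have h2 := Ring.choose_smul_choose N hms
      have h3 : (-1 : ℤ) ^ (s - m) = (-1) ^ s * (-1) ^ m := by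
        obtain ⟨d, rfl⟩ := Nat.exists_eq_add_of_le hms
        rw [Nat.add_sub_cancel_left, pow_add]
        have : (-1 : ℤ) ^ m * (-1) ^ m = 1 := by rw [← mul_pow]; simp
        linear_combination (-(-1 : ℤ) ^ d) * this
      rw [nsmul_eq_mul] at h2
      rw [h3]
      linear_combination (-((-1 : ℤ) ^ s * (-1) ^ m)) * h2
    rw [Finset.sum_congr rfl h1, ← Finset.mul_sum, Int.alternating_sum_range_choose]
    split_ifs with h
    · subst h; simp
    · simp
  simp only [Finset.smul_sum, smul_smul]
  rw [← Finset.sum_range_diag_flip (n + 1)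
    (fun m i => (Ring.choose N m * ((-1 : ℤ) ^ i * Ring.choose (N - m) i)) • x (m + i))]
  have h : ∀ s ∈ Finset.range (n + 1), ∑ m ∈ Finset.range (s + 1),
      (Ring.choose N m * ((-1 : ℤ) ^ (s - m) * Ring.choose (N - m) (s - m))) • x (m + (s - m))
        = (if s = 0 then (1 : ℤ) else 0) • x s := by
    intro s _
    rw [← hcoef, Finset.sum_smul]
    refine Finset.sum_congr rfl fun m hm => ?_
    rw [Nat.add_sub_cancel' (Nat.lt_succ_iff.1 (Finset.mem_range.1 hm))]
  rw [Finset.sum_congr rfl h, Finset.sum_eq_single 0] <;> simp +contextual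

/-- The truncated sum over `m` inverts the expansion of `(1 - x)^(N - m)`: only the leading term
of the sequence survives, as the coefficient of `x s` is `binom(N, s) (1 - 1)^s`. -/
theorem sum_range_choose_smul_finsum_alternating {X : Type*} [AddCommGroup X] (N : ℤ) (n : ℕ)
    (x : ℕ → X) (hx : ∀ s, n < s → x s = 0) :
    ∑ m ∈ Finset.range (n + 1), Ring.choose N m •
      ∑ᶠ i : ℕ, ((-1 : ℤ) ^ i * Ring.choose (N - m) i) • x (m + i) = x 0 := by
  rw [← sum_range_choose_smul_alternating N n x]
  refine Finset.sum_congr rfl fun m _ => ?_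
  congr 1
  refine finsum_eq_sum_of_support_subset _ fun i hi => ?_
  rw [Finset.mem_coe, Finset.mem_range]
  by_contra hcon
  refine hi ?_
  beta_reduce
  rw [hx _ (by omega), smul_zero]

/-! ### Sums of modes of a vertex operator -/

namespace VertexOperator

variable {W : Type*} [AddCommGroup W] [Module ℂ W]

theorem finite_support_smul_ncoeff (A : VertexOperator ℂ W) (c : ℕ → ℤ) (r : ℤ) (w : W) :
    (Function.support fun i : ℕ => c i • A.ncoeff (r + i) w).Finite := by
  refine (Set.finite_lt_nat
    (-r - ((HahnModule.of ℂ).symm (A w)).order).toNat).subset fun i hi => ?_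
  by_contra hcon
  refine hi ?_
  simp only [Set.mem_ofPred_eq] at hcon
  change c i • A.ncoeff (r + i) w = 0
  rw [ncoeff_eq_zero_of_lt_order A _ _ (by omega), smul_zero]

/-- The endomorphism `∑_{i ≥ 0} c i • A_{r + i}`; on each vector the sum is finite, by the lower
truncation of `A`. -/
noncomputable def modeSum (A : VertexOperator ℂ W) (c : ℕ → ℤ) (r : ℤ) : Module.End ℂ W where
  toFun w := ∑ᶠ i : ℕ, c i • A.ncoeff (r + i) w
  map_add' w w' := by
    rw [← finsum_add_distrib (A.finite_support_smul_ncoeff c r w)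
      (A.finite_support_smul_ncoeff c r w')]
    exact finsum_congr fun i => by rw [map_add, smul_add]
  map_smul' z w := by
    rw [RingHom.id_apply, smul_finsum' z (A.finite_support_smul_ncoeff c r w)]
    exact finsum_congr fun i => by rw [map_smul, smul_comm]

theorem modeSum_apply (A : VertexOperator ℂ W) (c : ℕ → ℤ) (r : ℤ) (w : W) :
    A.modeSum c r w = ∑ᶠ i : ℕ, c i • A.ncoeff (r + i) w := rfl

theorem map_modeSum {X F : Type*} [AddCommGroup X] [FunLike F W X] [AddMonoidHomClass F W X]
    (φ : F) (A : VertexOperator ℂ W) (c : ℕ → ℤ) (r : ℤ) (w : W) :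
    φ (A.modeSum c r w) = ∑ᶠ i : ℕ, c i • φ (A.ncoeff (r + i) w) := by
  rw [modeSum_apply, map_finsum φ (A.finite_support_smul_ncoeff c r w)]
  exact finsum_congr fun i => map_zsmul φ _ _

end VertexOperator

/-! ### Weights of modes -/

section Weights

variable {V : Type u} [AddCommGroup V] [Module ℂ V] {𝒱 : GradingRestrictedVertexAlgebra V}
  {W : Type v} [AddCommGroup W] [Module ℂ W]

theorem GradingRestrictedVertexAlgebra.comp_of_mem {a : ℤ} {v : V} (hv : v ∈ 𝒱.wt a) :
    𝒱.comp a v = v := homComponent_of_mem 𝒱.isInternal hv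

theorem GradingRestrictedVertexAlgebra.comp_of_mem_ne {a b : ℤ} (hab : a ≠ b) {v : V}
    (hv : v ∈ 𝒱.wt a) : 𝒱.comp b v = 0 := homComponent_of_mem_ne 𝒱.isInternal hab hv

namespace LowerBoundedGeneralizedModule

variable (M : LowerBoundedGeneralizedModule 𝒱 W)

theorem comp_of_mem {h : ℂ} {w : W} (hw : w ∈ M.wt h) : M.comp h w = w :=
  homComponent_of_mem M.isInternal hw

theorem comp_of_mem_ne {h h' : ℂ} (hh : h ≠ h') {w : W} (hw : w ∈ M.wt h) : M.comp h' w = 0 :=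
  homComponent_of_mem_ne M.isInternal hh hw

theorem mem_wt_iff {h : ℂ} {w : W} :
    w ∈ M.wt h ↔ ∃ s : ℕ, ((M.L0 - h • (1 : Module.End ℂ W)) ^ s) w = 0 :=
  Module.End.mem_maxGenEigenspace _ _ _

theorem ncoeff_mem_wt {a : ℤ} {v : V} (hv : v ∈ 𝒱.wt a) {h : ℂ} {w : W} (hw : w ∈ M.wt h)
    (n : ℤ) {e : ℂ} (he : e = a + h - n - 1) : (M.Y v).ncoeff n w ∈ M.wt e := by
  have key : ∀ x : W, (M.L0 - e • (1 : Module.End ℂ W)) ((M.Y v).ncoeff n x)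
      = (M.Y v).ncoeff n ((M.L0 - h • (1 : Module.End ℂ W)) x) := by
    intro x
    have h1 := M.L0_bracket v x n
    rw [𝒱.L0_apply a v hv, map_smul, map_smul, Pi.smul_apply, LinearMap.smul_apply,
      ← Int.cast_smul_eq_zsmul ℂ, sub_eq_iff_eq_add] at h1
    simp only [LinearMap.sub_apply, LinearMap.smul_apply, Module.End.one_apply, map_sub, map_smul]
    rw [h1, he]
    push_cast
    module
  rw [mem_wt_iff] at hw ⊢
  obtain ⟨s, hs⟩ := hw
  refine ⟨s, ?_⟩
  have hpow : ∀ (s : ℕ) (x : W), ((M.L0 - e • (1 : Module.End ℂ W)) ^ s) ((M.Y v).ncoeff n x)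
      = (M.Y v).ncoeff n (((M.L0 - h • (1 : Module.End ℂ W)) ^ s) x) := by
    intro s
    induction s with
    | zero => intro x; simp
    | succ s ih =>
      intro x
      rw [pow_succ, Module.End.mul_apply, key, ih, pow_succ, Module.End.mul_apply]
  rw [hpow, hs, map_zero]

theorem IsLevel.wt_eq_bot {M : LowerBoundedGeneralizedModule 𝒱 W} {n : ℕ} {f e : ℂ}
    (hf : M.IsLevel n f) (z : ℤ) (hz : z < 0) (he : e = f - n + z) : M.wt e = ⊥ := by
  obtain ⟨h, -, h2, rfl⟩ := hf
  have hc : (((-z - 1).toNat : ℕ) : ℂ) = ((-z - 1 : ℤ) : ℂ) := by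
    rw [← Int.cast_natCast, Int.toNat_of_nonneg (by omega)]
  have h3 := h2 (-z - 1).toNat
  rw [hc] at h3
  rw [← h3, he]
  congr 1
  push_cast
  ring

end LowerBoundedGeneralizedModule

end Weights

namespace IntertwiningOperator

variable {V : Type u} [AddCommGroup V] [Module ℂ V] {𝒱 : GradingRestrictedVertexAlgebra V}
  {W₁ : Type v₁} [AddCommGroup W₁] [Module ℂ W₁] {W₂ : Type v₂} [AddCommGroup W₂] [Module ℂ W₂]
  {W₃ : Type v₃} [AddCommGroup W₃] [Module ℂ W₃]
  {M₁ : LowerBoundedGeneralizedModule 𝒱 W₁} {M₂ : LowerBoundedGeneralizedModule 𝒱 W₂}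
  {M₃ : LowerBoundedGeneralizedModule 𝒱 W₃}

/-- Modulo weights, `L(0)` acts on a mode `𝒴_{m,k}(w) w₂` by three pairwise commuting nilpotent
operations: the nilpotent parts of `L(0)` on `w` and on `w₂`, and the shift `k ↦ k + 1`, nilpotent
since `𝒴` is polynomial in `log x`. -/
theorem L0_sub_mode (I : IntertwiningOperator M₁ M₂ M₃) {e h g m : ℂ} (he : e = h + g - m - 1)
    (k : ℕ) (w : W₁) (w₂ : W₂) :
    (M₃.L0 - e • (1 : Module.End ℂ W₃)) (I.mode m k w w₂)
      = I.mode m k ((M₁.L0 - h • (1 : Module.End ℂ W₁)) w) w₂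
        + I.mode m k w ((M₂.L0 - g • (1 : Module.End ℂ W₂)) w₂)
        + ((k : ℂ) + 1) • I.mode m (k + 1) w w₂ := by
  have h1 := I.L0_bracket w w₂ m k
  rw [I.Lm1_derivative w w₂ (m + 1) k, add_sub_cancel_right, sub_eq_iff_eq_add] at h1
  simp only [LinearMap.sub_apply, LinearMap.smul_apply, Module.End.one_apply, map_sub, map_smul]
  rw [h1, he]
  module

theorem mode_mem_wt (I : IntertwiningOperator M₁ M₂ M₃) {h g : ℂ} {w : W₁} {w₂ : W₂}
    (hw : w ∈ M₁.wt h) (hw₂ : w₂ ∈ M₂.wt g) (m : ℂ) (k : ℕ) {e : ℂ} (he : e = h + g - m - 1) :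
    I.mode m k w w₂ ∈ M₃.wt e := by
  rw [LowerBoundedGeneralizedModule.mem_wt_iff] at hw hw₂ ⊢
  obtain ⟨A, hA⟩ := hw
  obtain ⟨B, hB⟩ := hw₂
  set N₁ := M₁.L0 - h • (1 : Module.End ℂ W₁) with hN₁
  set N₂ := M₂.L0 - g • (1 : Module.End ℂ W₂) with hN₂
  set N₃ := M₃.L0 - e • (1 : Module.End ℂ W₃) with hN₃
  obtain ⟨K, hK⟩ : ∃ K : ℕ, ∀ i < A, ∀ j < B, ∀ k ≥ K,
      I.mode m k ((N₁ ^ i) w) ((N₂ ^ j) w₂) = 0 := by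
    have hfin : (⋃ i ∈ Set.Iio A, ⋃ j ∈ Set.Iio B,
        {k | I.mode m k ((N₁ ^ i) w) ((N₂ ^ j) w₂) ≠ 0}).Finite :=
      (Set.finite_Iio A).biUnion fun i _ => (Set.finite_Iio B).biUnion fun j _ =>
        I.polynomial_log _ _ _
    obtain ⟨b, hb⟩ := hfin.bddAbove
    refine ⟨b + 1, fun i hi j hj k hk => ?_⟩
    by_contra h0
    have : k ≤ b := hb (Set.mem_biUnion (show i ∈ Set.Iio A from hi)
      (Set.mem_biUnion (show j ∈ Set.Iio B from hj) h0))
    omega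
  have hA' : ∀ i, A ≤ i → (N₁ ^ i) w = 0 := by
    intro i hi
    obtain ⟨d, rfl⟩ := Nat.exists_eq_add_of_le hi
    rw [add_comm, pow_add, Module.End.mul_apply, hA, map_zero]
  have hB' : ∀ j, B ≤ j → (N₂ ^ j) w₂ = 0 := by
    intro i hi
    obtain ⟨d, rfl⟩ := Nat.exists_eq_add_of_le hi
    rw [add_comm, pow_add, Module.End.mul_apply, hB, map_zero]
  have main : ∀ s i j k : ℕ, A + B + K ≤ s + i + j + k →
      (N₃ ^ s) (I.mode m k ((N₁ ^ i) w) ((N₂ ^ j) w₂)) = 0 := by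
    intro s
    induction s with
    | zero =>
      intro i j k hs
      rw [pow_zero, Module.End.one_apply]
      by_cases hi : A ≤ i
      · rw [hA' i hi, map_zero, LinearMap.zero_apply]
      by_cases hj : B ≤ j
      · rw [hB' j hj, map_zero]
      exact hK i (by omega) j (by omega) k (by omega)
    | succ s ih =>
      intro i j k hs
      rw [pow_succ, Module.End.mul_apply, hN₃, I.L0_sub_mode he, ← hN₁, ← hN₂, ← hN₃,
        ← Module.End.mul_apply N₁, ← Module.End.mul_apply N₂, ← pow_succ', ← pow_succ',
        map_add, map_add, map_smul, ih _ _ _ (by omega), ih _ _ _ (by omega),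
        ih _ _ _ (by omega), smul_zero, add_zero, add_zero]
  exact ⟨A + B + K, by simpa using main (A + B + K) 0 0 k (by omega)⟩

end IntertwiningOperator

/-! ### The products of matrix units -/

section Products

variable {V : Type u} [AddCommGroup V] [Module ℂ V] {𝒱 : GradingRestrictedVertexAlgebra V}
  {W : Type v} [AddCommGroup W] [Module ℂ W]

theorem UInf.single_apply_same (k l : ℕ) (w : W) : (UInf.single k l w).1 k l = w :=
  Matrix.single_apply_same _ _ _

theorem UInf.single_apply_of_ne {k l k' l' : ℕ} (h : ¬(k = k' ∧ l = l')) (w : W) :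
    (UInf.single k l w).1 k' l' = 0 :=
  Matrix.single_apply_of_ne _ _ _ _ _ h

/-- The map `w ↦ [w]_{kl}` as a linear map. -/
def UInf.singleLinear (k l : ℕ) : W →ₗ[ℂ] UInf W where
  toFun := UInf.single k l
  map_add' w w' := Subtype.ext (Matrix.single_add k l w w')
  map_smul' z w := Subtype.ext (Matrix.smul_single z k l w).symm

theorem UInf.singleLinear_apply (k l : ℕ) (w : W) :
    UInf.singleLinear k l w = UInf.single k l w := rfl

theorem leftDiamond_single (M : LowerBoundedGeneralizedModule 𝒱 W) (k n l : ℕ) (v : V) (w : W) :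
    leftDiamond M (UInf.single k n v) (UInf.single n l w)
      = UInf.single k l (leftEntry M k n l v w) := by
  refine Subtype.ext (Matrix.ext fun k' l' => ?_)
  change ∑ᶠ n', leftEntry M k' n' l' ((UInf.single k n v).1 k' n') ((UInf.single n l w).1 n' l')
    = (UInf.single k l (leftEntry M k n l v w)).1 k' l'
  rw [finsum_eq_single _ n fun n' hn' => by
    rw [UInf.single_apply_of_ne (fun h => hn' h.2.symm), leftEntry_zero_left]]
  by_cases hk : k = k'
  · by_cases hl : l = l'
    · subst hk hl
      simp only [UInf.single_apply_same]
    · rw [UInf.single_apply_of_ne (fun h => hl h.2) w, leftEntry_zero_right,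
        UInf.single_apply_of_ne (fun h => hl h.2)]
  · rw [UInf.single_apply_of_ne (fun h => hk h.1) v, leftEntry_zero_left,
      UInf.single_apply_of_ne (fun h => hk h.1)]

theorem rightDiamond_single (M : LowerBoundedGeneralizedModule 𝒱 W) (k n l : ℕ) (w : W) (v : V) :
    rightDiamond M (UInf.single k n w) (UInf.single n l v)
      = UInf.single k l (rightEntry M k n l w v) := by
  refine Subtype.ext (Matrix.ext fun k' l' => ?_)
  change ∑ᶠ n', rightEntry M k' n' l' ((UInf.single k n w).1 k' n') ((UInf.single n l v).1 n' l')
    = (UInf.single k l (rightEntry M k n l w v)).1 k' l'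
  rw [finsum_eq_single _ n fun n' hn' => by
    rw [UInf.single_apply_of_ne (fun h => hn' h.2.symm), rightEntry_zero_left]]
  by_cases hk : k = k'
  · by_cases hl : l = l'
    · subst hk hl
      simp only [UInf.single_apply_same]
    · rw [UInf.single_apply_of_ne (fun h => hl h.2) v, rightEntry_zero_right,
        UInf.single_apply_of_ne (fun h => hl h.2)]
  · rw [UInf.single_apply_of_ne (fun h => hk h.1) w, rightEntry_zero_left,
      UInf.single_apply_of_ne (fun h => hk h.1)]

/-- `w ↦ leftEntry M k n l v w` as an endomorphism, for `v` of weight `a`. -/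
noncomputable def leftEntryEnd (M : LowerBoundedGeneralizedModule 𝒱 W) (k n l : ℕ) (a : ℤ)
    (v : V) : Module.End ℂ W :=
  ∑ m ∈ Finset.range (n + 1), Ring.choose (-k + n - l - 1 : ℤ) m •
    (M.Y v).modeSum (fun i => Ring.choose (l + a : ℤ) i) (-k + n - l - m - 1)

/-- `w ↦ rightEntry M k n l w v` as an endomorphism, for `v` of weight `a`. -/
noncomputable def rightEntryEnd (M : LowerBoundedGeneralizedModule 𝒱 W) (k n l : ℕ) (a : ℤ)
    (v : V) : Module.End ℂ W :=
  ∑ m ∈ Finset.range (n + 1), Ring.choose (-k + n - l - 1 : ℤ) m •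
    (M.Y v).modeSum (fun i => (((-1 : ℤˣ) ^ (-k + n - l - m - 1 + i + 1 : ℤ) : ℤˣ) : ℤ) *
      Ring.choose (k - a + (-k + n - l - m - 1 + i) + 1 : ℤ) i) (-k + n - l - m - 1)

theorem leftEntry_of_mem (M : LowerBoundedGeneralizedModule 𝒱 W) (k n l : ℕ) {a : ℤ} {v : V}
    (hv : v ∈ 𝒱.wt a) (w : W) : leftEntry M k n l v w = leftEntryEnd M k n l a v w := by
  rw [leftEntry, finsum_eq_single _ a fun b hb => by
    simp [GradingRestrictedVertexAlgebra.comp_of_mem_ne hb.symm hv],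
    GradingRestrictedVertexAlgebra.comp_of_mem hv, leftEntryEnd, LinearMap.sum_apply]
  rfl

theorem rightEntry_of_mem (M : LowerBoundedGeneralizedModule 𝒱 W) (k n l : ℕ) {a : ℤ} {v : V}
    (hv : v ∈ 𝒱.wt a) (w : W) : rightEntry M k n l w v = rightEntryEnd M k n l a v w := by
  rw [rightEntry, finsum_eq_single _ a fun b hb => by
    simp [GradingRestrictedVertexAlgebra.comp_of_mem_ne hb.symm hv],
    GradingRestrictedVertexAlgebra.comp_of_mem hv, rightEntryEnd, LinearMap.sum_apply]
  rfl

end Products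

/-! ### Components of `ϑ_𝒴` -/

namespace IntertwiningOperator

variable {V : Type u} [AddCommGroup V] [Module ℂ V] {𝒱 : GradingRestrictedVertexAlgebra V}
  {W₁ : Type v₁} [AddCommGroup W₁] [Module ℂ W₁] {W₂ : Type v₂} [AddCommGroup W₂] [Module ℂ W₂]
  {W₃ : Type v₃} [AddCommGroup W₃] [Module ℂ W₃]
  {M₁ : LowerBoundedGeneralizedModule 𝒱 W₁} {M₂ : LowerBoundedGeneralizedModule 𝒱 W₂}
  {M₃ : LowerBoundedGeneralizedModule 𝒱 W₃} (I : IntertwiningOperator M₁ M₂ M₃)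

theorem theta_single (k l : ℕ) (w : W₁) (w₂ : W₂) :
    I.theta (UInf.single k l w) w₂ = I.thetaEntry k l w w₂ := by
  change ∑ᶠ s : ℕ × ℕ, I.thetaEntry s.1 s.2 ((UInf.single k l w).1 s.1 s.2) w₂ = _
  rw [finsum_eq_single _ (k, l) fun s hs => by
    rw [UInf.single_apply_of_ne (fun h => hs (Prod.ext h.1.symm h.2.symm)), map_zero,
      LinearMap.zero_apply], UInf.single_apply_same]

/-- The component of weight `f` of `ϑ_𝒴([w]_{kl}) w₂`, as a linear function of `w`. -/
noncomputable def thetaComponent (k l : ℕ) (f : ℂ) (w₂ : W₂) : W₁ →ₗ[ℂ] W₃ :=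
  M₃.comp f ∘ₗ (I.thetaEntry k l).flip w₂

theorem thetaComponent_apply_of_mem {k l : ℕ} {h g f : ℂ} {w : W₁} {w₂ : W₂}
    (hw : w ∈ M₁.wt h) (hw₂ : w₂ ∈ M₂.wt g) :
    I.thetaComponent k l f w₂ w = M₃.comp f (I.thetaTerm k l (h, g, f) w w₂) := by
  change M₃.comp f (∑ᶠ t : ℂ × ℂ × ℂ, I.thetaTerm k l t w w₂) = _
  rw [map_finsum _ (I.thetaTerm_finite k l w w₂)]
  refine finsum_eq_single _ (h, g, f) ?_
  rintro ⟨h', g', f'⟩ hne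
  by_cases hl : M₂.IsLevel l g' ∧ M₃.IsLevel k f'
  · rw [I.thetaTerm_apply hl]
    dsimp only
    by_cases hh : h = h'
    · by_cases hg : g = g'
      · subst hh hg
        have hf : f' ≠ f := fun hf => hne (by rw [hf])
        rw [M₁.comp_of_mem hw, M₂.comp_of_mem hw₂]
        exact M₃.comp_of_mem_ne hf (I.mode_mem_wt hw hw₂ _ _ (by ring))
      · rw [M₂.comp_of_mem_ne hg hw₂, map_zero, map_zero]
    · rw [M₁.comp_of_mem_ne hh hw, map_zero, LinearMap.zero_apply, map_zero]
  · rw [I.thetaTerm_eq_zero hl, LinearMap.zero_apply, LinearMap.zero_apply, map_zero]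

theorem thetaComponent_of_isLevel {k l : ℕ} {h g f : ℂ} {w : W₁} {w₂ : W₂}
    (hw : w ∈ M₁.wt h) (hw₂ : w₂ ∈ M₂.wt g) (hg : M₂.IsLevel l g) (hf : M₃.IsLevel k f) :
    I.thetaComponent k l f w₂ w = I.mode (h + g - f - 1) 0 w w₂ := by
  rw [I.thetaComponent_apply_of_mem hw hw₂, I.thetaTerm_apply ⟨hg, hf⟩, M₁.comp_of_mem hw,
    M₂.comp_of_mem hw₂]
  exact M₃.comp_of_mem (I.mode_mem_wt hw hw₂ _ _ (by ring))

theorem thetaComponent_of_not_isLevel {k l : ℕ} {g f : ℂ} {w₂ : W₂} (hw₂ : w₂ ∈ M₂.wt g)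
    (hl : ¬(M₂.IsLevel l g ∧ M₃.IsLevel k f)) (w : W₁) :
    I.thetaComponent k l f w₂ w = 0 := by
  refine apply_eq_zero_of_isInternal M₁.isInternal _ (fun h w hw => ?_) w
  rw [I.thetaComponent_apply_of_mem hw hw₂, I.thetaTerm_eq_zero hl, LinearMap.zero_apply,
    LinearMap.zero_apply, map_zero]

/-- For `w₂` on level `l` and `f` on level `k`, the weight-`f` components of the
`ϑ_𝒴([v_{q+i} w]_{kl}) w₂` are the modes on the iterate side of the Jacobi identity, so their sum
with coefficients `binom(m, i)` equals the commutator side. -/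
theorem thetaComponent_modeSum {k l : ℕ} {h g f : ℂ} {w : W₁} {w₂ : W₂} {a : ℤ} {v : V}
    (hv : v ∈ 𝒱.wt a) (hw : w ∈ M₁.wt h) (hw₂ : w₂ ∈ M₂.wt g) (hg : M₂.IsLevel l g)
    (hf : M₃.IsLevel k f) (q m : ℤ) :
    I.thetaComponent k l f w₂ ((M₁.Y v).modeSum (fun i => Ring.choose m i) q w)
      = (∑ᶠ i : ℕ, ((-1 : ℤ) ^ i * Ring.choose q i) • (M₃.Y v).ncoeff (m + q - i)
          (I.mode (a + h + g - f - q - m - 2 + i) 0 w w₂))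
        - ∑ᶠ i : ℕ, ((((-1 : ℤˣ) ^ (q - i) : ℤˣ) : ℤ) * Ring.choose q i) •
          I.mode (a + h + g - f - m - 2 - i) 0 w ((M₂.Y v).ncoeff (m + i) w₂) := by
  have hJ := I.jacobi v w w₂ q m (a + h + g - f - q - m - 2) 0
  rw [VertexOperator.map_modeSum]
  refine Eq.trans (finsum_congr fun i => ?_) (hJ.symm.trans ?_)
  · rw [I.thetaComponent_of_isLevel (M₁.ncoeff_mem_wt hv hw (q + i) rfl) hw₂ hg hf]
    congr 4
    push_cast
    ring
  · congr 1
    refine finsum_congr fun i => ?_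
    congr 4
    ring

/-- `ϑ_𝒴` turns the left action into composition: `[v]_{kn} ⋄ [w]_{nl}` acts on level `l` as the
mode of `w` to level `n` followed by the mode of `v` to level `k`. -/
theorem thetaComponent_leftEntryEnd {k n l : ℕ} {h g f : ℂ} {w : W₁} {w₂ : W₂} {a : ℤ} {v : V}
    (hv : v ∈ 𝒱.wt a) (hw : w ∈ M₁.wt h) (hw₂ : w₂ ∈ M₂.wt g) (hg : M₂.IsLevel l g)
    (hf : M₃.IsLevel k f) :
    I.thetaComponent k l f w₂ (leftEntryEnd M₁ k n l a v w)
      = (M₃.Y v).ncoeff (a + n - k - 1) (I.mode (h + g - f + k - n - 1) 0 w w₂) := by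
  have hsum := sum_range_choose_smul_finsum_alternating (-k + n - l - 1 : ℤ) n
    (fun s : ℕ => (M₃.Y v).ncoeff (a + n - k - 1 - s)
      (I.mode (h + g - f + k - n - 1 + s) 0 w w₂)) (fun s hs => by
        have hmem := I.mode_mem_wt hw hw₂ (h + g - f + k - n - 1 + s) 0 rfl
        rw [hf.wt_eq_bot (n - s) (by omega) (by push_cast; ring), Submodule.mem_bot] at hmem
        rw [hmem, map_zero])
  simp only [Nat.cast_zero, sub_zero, add_zero] at hsum
  rw [← hsum, leftEntryEnd, LinearMap.sum_apply, map_sum]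
  refine Finset.sum_congr rfl fun m _ => ?_
  rw [LinearMap.smul_apply, map_zsmul, I.thetaComponent_modeSum hv hw hw₂ hg hf]
  congr 1
  -- The modes of `v` lower `w₂` below the lowest level of its class.
  have hzero : ∀ i : ℕ, (M₂.Y v).ncoeff (l + a + i : ℤ) w₂ = 0 := by
    intro i
    have hmem := M₂.ncoeff_mem_wt hv hw₂ (l + a + i : ℤ) rfl
    rwa [hg.wt_eq_bot (-i - 1) (by omega) (by push_cast; ring), Submodule.mem_bot] at hmem
  simp only [hzero, map_zero, smul_zero, finsum_zero, sub_zero]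
  refine finsum_congr fun i => ?_
  congr 3
  · ring
  · refine congrArg _ ?_
    push_cast
    ring
  · congr 2
    push_cast
    ring

/-- `ϑ_𝒴` turns the right action into composition: `[w]_{kn} ⋄ [v]_{nl}` acts on level `l` as the
mode of `v` to level `n` followed by the mode of `w` to level `k`. -/
theorem thetaComponent_rightEntryEnd {k n l : ℕ} {h g f : ℂ} {w : W₁} {w₂ : W₂} {a : ℤ} {v : V}
    (hv : v ∈ 𝒱.wt a) (hw : w ∈ M₁.wt h) (hw₂ : w₂ ∈ M₂.wt g) (hg : M₂.IsLevel l g)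
    (hf : M₃.IsLevel k f) :
    I.thetaComponent k l f w₂ (rightEntryEnd M₁ k n l a v w)
      = I.mode (h + g - f + n - l - 1) 0 w ((M₂.Y v).ncoeff (a + l - n - 1) w₂) := by
  have hsum := sum_range_choose_smul_finsum_alternating (-k + n - l - 1 : ℤ) n
    (fun s : ℕ => I.mode (h + g - f + n - l - 1 - s) 0 w
      ((M₂.Y v).ncoeff (a + l - n - 1 + s) w₂)) (fun s hs => by
        have hmem := M₂.ncoeff_mem_wt hv hw₂ (a + l - n - 1 + s) rfl
        rw [hg.wt_eq_bot (n - s) (by omega) (by push_cast; ring), Submodule.mem_bot] at hmem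
        rw [hmem, map_zero])
  simp only [Nat.cast_zero, sub_zero, add_zero] at hsum
  rw [← hsum, rightEntryEnd, LinearMap.sum_apply, map_sum]
  refine Finset.sum_congr rfl fun m _ => ?_
  rw [LinearMap.smul_apply, map_zsmul]
  congr 1
  set q : ℤ := -k + n - l - m - 1 with hq
  -- `binom(x + i, i) = (-1)^i binom(-x - 1, i)` brings the coefficients into Jacobi form.
  have hcoef : ∀ i : ℕ, (((-1 : ℤˣ) ^ (q + i + 1 : ℤ) : ℤˣ) : ℤ) *
      Ring.choose (k - a + (q + i) + 1 : ℤ) i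
        = (((-1 : ℤˣ) ^ (q + 1 : ℤ) : ℤˣ) : ℤ) * Ring.choose (a - k - q - 2 : ℤ) i := by
    intro i
    have h1 := Ring.choose_neg (-(a - k - q - 2) : ℤ) i
    rw [neg_neg, show (-(a - k - q - 2) + i - 1 : ℤ) = k - a + (q + i) + 1 by ring,
      Int.negOnePow_def, Units.smul_def, smul_eq_mul] at h1
    rw [h1, ← mul_assoc, ← Units.val_mul, ← zpow_add]
    congr 3
    ring
  have hsplit : (M₁.Y v).modeSum (fun i => (((-1 : ℤˣ) ^ (q + i + 1 : ℤ) : ℤˣ) : ℤ) *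
      Ring.choose (k - a + (q + i) + 1 : ℤ) i) q w
        = (((-1 : ℤˣ) ^ (q + 1 : ℤ) : ℤˣ) : ℤ) •
          (M₁.Y v).modeSum (fun i => Ring.choose (a - k - q - 2 : ℤ) i) q w := by
    rw [← zsmulAddGroupHom_apply, VertexOperator.map_modeSum, VertexOperator.modeSum_apply]
    exact finsum_congr fun i => by
      rw [hcoef, zsmulAddGroupHom_apply, mul_comm, mul_smul]
  rw [hsplit, map_zsmul, I.thetaComponent_modeSum hv hw hw₂ hg hf]
  -- The modes of `w` lower `w₂` below the lowest level of the class of `f`.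
  have hzero : ∀ i : ℕ,
      I.mode (a + h + g - f - q - (a - k - q - 2 : ℤ) - 2 + i) 0 w w₂ = 0 := by
    intro i
    have hmem := I.mode_mem_wt hw hw₂
      (a + h + g - f - q - (a - k - q - 2 : ℤ) - 2 + i) 0 rfl
    rwa [hf.wt_eq_bot (-i - 1) (by omega) (by push_cast; ring), Submodule.mem_bot] at hmem
  simp only [hzero, map_zero, smul_zero, finsum_zero, zero_sub]
  have hunit : ∀ (ε : ℤˣ) (F : ℕ → W₃), ((ε : ℤˣ) : ℤ) • -(∑ᶠ i, F i)
      = ∑ᶠ i, (-(ε : ℤ)) • F i := by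
    intro ε F
    rcases Int.units_eq_one_or ε with rfl | rfl
    · simp [finsum_neg_distrib]
    · simp
  rw [hunit]
  refine finsum_congr fun i => ?_
  rw [smul_smul]
  congr 1
  · rw [← mul_assoc, neg_mul, ← Units.val_mul, ← zpow_add,
      show q + 1 + (q - i) = 2 * (q - i) + (i + 1) by ring, zpow_add, zpow_mul]
    rw [show ((-1 : ℤˣ) ^ (2 : ℤ)) = 1 from rfl, one_zpow, one_mul,
      show ((i : ℤ) + 1) = ((i + 1 : ℕ) : ℤ) by push_cast; rfl, zpow_natCast, pow_succ]
    rw [show (-k + n - l - 1 - m : ℤ) = q by rw [hq]; ring]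
    push_cast
    ring
  · congr 3
    · rw [hq]
      push_cast
      ring
    · refine congrArg _ ?_
      rw [hq]
      push_cast
      ring

end IntertwiningOperator

/-! ### The Jacobi identity for matrix units -/

namespace IntertwiningOperator

variable {V : Type u} [AddCommGroup V] [Module ℂ V] {𝒱 : GradingRestrictedVertexAlgebra V}
  {W₁ : Type v₁} [AddCommGroup W₁] [Module ℂ W₁] {W₂ : Type v₂} [AddCommGroup W₂] [Module ℂ W₂]
  {W₃ : Type v₃} [AddCommGroup W₃] [Module ℂ W₃]
  {M₁ : LowerBoundedGeneralizedModule 𝒱 W₁} {M₂ : LowerBoundedGeneralizedModule 𝒱 W₂}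
  {M₃ : LowerBoundedGeneralizedModule 𝒱 W₃} (I : IntertwiningOperator M₁ M₂ M₃)

theorem thetaComponent_jacobi {k l n : ℕ} {p : ℤ} (hlp : 0 ≤ (l : ℤ) + p) {a : ℤ} {v : V}
    (hv : v ∈ 𝒱.wt a) {h g : ℂ} (f : ℂ) {w : W₁} {w₂ : W₂} (hw : w ∈ M₁.wt h)
    (hw₂ : w₂ ∈ M₂.wt g) :
    I.thetaComponent k ((l : ℤ) + p).toNat f w₂
      ((∑ j ∈ Finset.range ((n : ℤ) + p + 1).toNat, ((-1 : ℤ) ^ j * Ring.choose p j) •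
          leftEntryEnd M₁ k ((n : ℤ) + p - j).toNat ((l : ℤ) + p).toNat a v w)
        - (∑ j ∈ Finset.range ((l : ℤ) - n + k + p + 1).toNat,
          ((((-1 : ℤˣ) ^ (p - j) : ℤˣ) : ℤ) * Ring.choose p j) •
            rightEntryEnd M₁ k ((l : ℤ) - n + k + p - j).toNat ((l : ℤ) + p).toNat a v w)
        - (M₁.Y v).modeSum (fun j => Ring.choose (a + n - k - 1) j) p w) = 0 := by
  set L := ((l : ℤ) + p).toNat with hL
  have hLz : (L : ℤ) = l + p := Int.toNat_of_nonneg hlp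
  have hLc : (L : ℂ) = l + p := by exact_mod_cast congrArg (Int.cast : ℤ → ℂ) hLz
  by_cases hlev : M₂.IsLevel L g ∧ M₃.IsLevel k f
  swap
  · exact I.thetaComponent_of_not_isLevel hw₂ hlev _
  obtain ⟨hg, hf⟩ := hlev
  rw [map_sub, map_sub, map_sum, map_sum, I.thetaComponent_modeSum hv hw hw₂ hg hf, sub_eq_zero]
  congr 1
  · rw [finsum_eq_sum_of_support_subset (s := Finset.range ((n : ℤ) + p + 1).toNat)]
    · refine Finset.sum_congr rfl fun j hj => ?_
      rw [Finset.mem_range] at hj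
      have hz : ((((n : ℤ) + p - j).toNat : ℕ) : ℤ) = n + p - j :=
        Int.toNat_of_nonneg (by omega)
      have hc : ((((n : ℤ) + p - j).toNat : ℕ) : ℂ) = n + p - j := by
        exact_mod_cast congrArg (Int.cast : ℤ → ℂ) hz
      rw [map_zsmul, I.thetaComponent_leftEntryEnd hv hw hw₂ hg hf, hz, hc]
      congr 3
      · refine congrArg _ ?_
        ring
      · congr 2
        push_cast
        ring
    · -- The remaining modes of `w` take `w₂` below the lowest level of the class of `f`.
      intro j hj
      rw [Finset.mem_coe, Finset.mem_range]
      by_contra hcon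
      have hmem := I.mode_mem_wt hw hw₂
        (a + h + g - f - p - (a + n - k - 1 : ℤ) - 2 + j) 0 rfl
      rw [hf.wt_eq_bot (n + p - j) (by omega) (by push_cast; ring), Submodule.mem_bot] at hmem
      refine hj ?_
      beta_reduce
      rw [hmem, map_zero, smul_zero]
  · rw [finsum_eq_sum_of_support_subset (s := Finset.range ((l : ℤ) - n + k + p + 1).toNat)]
    · refine Finset.sum_congr rfl fun j hj => ?_
      rw [Finset.mem_range] at hj
      have hz : ((((l : ℤ) - n + k + p - j).toNat : ℕ) : ℤ) = l - n + k + p - j :=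
        Int.toNat_of_nonneg (by omega)
      have hc : ((((l : ℤ) - n + k + p - j).toNat : ℕ) : ℂ) = l - n + k + p - j := by
        exact_mod_cast congrArg (Int.cast : ℤ → ℂ) hz
      rw [map_zsmul, I.thetaComponent_rightEntryEnd hv hw hw₂ hg hf, hz, hc, hLz, hLc]
      congr 4
      · push_cast
        ring
      · refine congrArg _ ?_
        ring
    · -- The remaining modes of `v` take `w₂` below the lowest level of its class.
      intro j hj
      rw [Finset.mem_coe, Finset.mem_range]
      by_contra hcon
      have hmem := M₂.ncoeff_mem_wt hv hw₂ (a + n - k - 1 + j : ℤ) rfl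
      rw [hg.wt_eq_bot (l - n + k + p - j) (by omega) (by rw [hLc]; push_cast; ring),
        Submodule.mem_bot] at hmem
      refine hj ?_
      beta_reduce
      rw [hmem, map_zero, smul_zero]

/-- A matrix unit `[u w]_{kl}`, depending linearly on `w`, is killed by `ϑ_𝒴` once the components
of `ϑ_𝒴([u w]_{kl}) w₂` vanish for homogeneous `w` and `w₂`. -/
theorem theta_single_eq_zero {k l : ℕ} (u : Module.End ℂ W₁)
    (hu : ∀ (h g f : ℂ) (w : W₁) (w₂ : W₂), w ∈ M₁.wt h → w₂ ∈ M₂.wt g →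
      I.thetaComponent k l f w₂ (u w) = 0) (w : W₁) :
    I.theta (UInf.single k l (u w)) = 0 := by
  refine LinearMap.ext fun w₂ => ?_
  refine apply_eq_zero_of_isInternal M₂.isInternal (I.theta (UInf.single k l (u w)))
    (fun g w₂ hw₂ => ?_) w₂
  rw [theta_single]
  refine apply_eq_zero_of_isInternal M₁.isInternal ((I.thetaEntry k l).flip w₂ ∘ₗ u)
    (fun h w hw => ?_) w
  exact eq_zero_of_homComponent_eq_zero M₃.isInternal fun f => hu h g f w w₂ hw hw₂

end IntertwiningOperator

theorem finsum_nonneg_sub_eq_sum {X : Type*} [AddCommMonoid X] (N : ℤ) (F : ℕ → X) :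
    ∑ᶠ (j : ℕ) (_ : 0 ≤ N - j), F j = ∑ j ∈ Finset.range (N + 1).toNat, F j :=
  finsum_cond_eq_sum_of_cond_iff _ fun {j} _ => by
    rw [Finset.mem_range]
    omega

theorem proposition4p4 {V : Type u} [AddCommGroup V] [Module ℂ V]
    (𝒱 : GradingRestrictedVertexAlgebra V)
    {W : Type v} [AddCommGroup W] [Module ℂ W] (M : LowerBoundedGeneralizedModule 𝒱 W)
    (k l n : ℕ) (p : ℤ) (hlp : 0 ≤ (l : ℤ) + p)
    (a : ℤ) (v : V) (hv : v ∈ 𝒱.wt a) (w : W) :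
    (∑ᶠ (j : ℕ) (_ : 0 ≤ (n : ℤ) + p - j), ((-1 : ℤ) ^ j * Ring.choose p j) •
        leftDiamond M (UInf.single k ((n : ℤ) + p - j).toNat v)
          (UInf.single ((n : ℤ) + p - j).toNat ((l : ℤ) + p).toNat w))
      - (∑ᶠ (j : ℕ) (_ : 0 ≤ (l : ℤ) - n + k + p - j),
        ((((-1 : ℤˣ) ^ (p - j) : ℤˣ) : ℤ) * Ring.choose p j) •
          rightDiamond M (UInf.single k ((l : ℤ) - n + k + p - j).toNat w)
            (UInf.single ((l : ℤ) - n + k + p - j).toNat ((l : ℤ) + p).toNat v))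
      - (∑ᶠ j : ℕ, Ring.choose (a + n - k - 1) j •
        UInf.single k ((l : ℤ) + p).toNat ((M.Y v).ncoeff (p + j) w))
      ∈ QInf.{u, v, v₂, v₃} M := by
  set L := ((l : ℤ) + p).toNat
  let u : Module.End ℂ W :=
    (∑ j ∈ Finset.range ((n : ℤ) + p + 1).toNat, ((-1 : ℤ) ^ j * Ring.choose p j) •
        leftEntryEnd M k ((n : ℤ) + p - j).toNat L a v)
      - (∑ j ∈ Finset.range ((l : ℤ) - n + k + p + 1).toNat,
        ((((-1 : ℤˣ) ^ (p - j) : ℤˣ) : ℤ) * Ring.choose p j) •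
          rightEntryEnd M k ((l : ℤ) - n + k + p - j).toNat L a v)
      - (M.Y v).modeSum (fun j => Ring.choose (a + n - k - 1) j) p
  have hu : ∀ w, u w =
      (∑ j ∈ Finset.range ((n : ℤ) + p + 1).toNat, ((-1 : ℤ) ^ j * Ring.choose p j) •
        leftEntryEnd M k ((n : ℤ) + p - j).toNat L a v w)
      - (∑ j ∈ Finset.range ((l : ℤ) - n + k + p + 1).toNat,
        ((((-1 : ℤˣ) ^ (p - j) : ℤˣ) : ℤ) * Ring.choose p j) •
          rightEntryEnd M k ((l : ℤ) - n + k + p - j).toNat L a v w)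
      - (M.Y v).modeSum (fun j => Ring.choose (a + n - k - 1) j) p w := fun w => by
    simp only [u, LinearMap.sub_apply, LinearMap.sum_apply, LinearMap.smul_apply]
  have key : UInf.single k L (u w) ∈ QInf.{u, v, v₂, v₃} M := by
    intro W₂ _ _ W₃ _ _ M₂ M₃ I
    rw [LinearMap.mem_ker]
    refine I.theta_single_eq_zero u (fun h g f w w₂ hw hw₂ => ?_) w
    rw [hu]
    exact I.thetaComponent_jacobi hlp hv f hw hw₂
  rw [← UInf.singleLinear_apply, hu, map_sub, map_sub, map_sum, map_sum,
    VertexOperator.map_modeSum] at key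
  rw [finsum_nonneg_sub_eq_sum, finsum_nonneg_sub_eq_sum]
  simpa only [leftDiamond_single, rightDiamond_single, leftEntry_of_mem M _ _ _ hv,
    rightEntry_of_mem M _ _ _ hv, map_zsmul, UInf.singleLinear_apply] using key
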